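/- Let $d\ge 1$, equip $[0,1]^d$ with the Euclidean metric, and let $\nu$ be a non-atomic Borel probability measure on $[0,1]^d$. For Borel probability measures $\rho,\rho'$ on $[0,1]^d$ let $$\mathcal W(\rho,\rho')=\inf_{\gamma}\int |x-y|_2\,\gamma(dx,dy),$$ the infimum being over all couplings $\gamma$ of $\rho$ and $\rho'$. For a probability measure $\theta$ on $[0,1]^d\times[0,1]^d$ with marginals $\theta_1,\theta_2$ and disintegration $\theta(dx_1,dx_2)=\theta_{x_1}(dx_2)\,\theta_1(dx_1)$ define the Wasserstein correlation coefficient $$\overrightarrow{\mathcal W}(\theta)=\frac{\int \mathcal W(\theta_{x_1},\theta_2)\,\theta_1(dx_1)}{\iint |y-z|_2\,\theta_2(dy)\,\theta_2(dz)},$$ with $\overrightarrow{\mathcal W}(\theta)=0$ if the denominator vanishes. Then there is a constant $C=C(\nu)>0$ such that the following holds. Let $\mu$ be any non-atomic Borel probability measure on $[0,1]^d$ and let $(X_1^n,X_2^n)_{n\ge 1}$ be i.i.d. with law $\mu\otimes\nu$. For every $N$ let $\Phi^N$ be a partition of $[0,1]^d$ into finitely many disjoint (axis-parallel) cubes, let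 $|\Phi^N|$ be their number, let $\varphi^N:[0,1]^d\to[0,1]^d$ map each cube to its centre, and assume that $\lim_{N\to\infty}\sup_x|\varphi^N(x)-x|_2=0$. Let $$\hat\pi^N=\frac1N\sum_{n=1}^N\delta_{(\varphi^N(X_1^n),\,\varphi^N(X_2^n))}$$ be the adapted empirical measure. Then for every $\alpha\in(0,1)$ the test which rejects independence if $$\overrightarrow{\mathcal W}(\hat\pi^N)>C(\nu)\left(\sqrt{\frac{2}{\pi}}\,\frac{|\Phi^N|}{\sqrt N}+\frac{\sigma}{\sqrt N}\,\Phi^{-1}(1-\alpha)\right),\qquad \sigma=1-\frac{2}{\pi},$$ (here $\pi=3.14\ldots$, and $\Phi^{-1}$ is the quantile function of the standard normal distribution) has asymptotic significance level $\alpha$, that is, $$\limsup_{N\to\infty}P\left(\overrightarrow{\mathcal W}(\hat\pi^N)>C(\nu)\left(\sqrt{\frac{2}{\pi}}\,\frac{|\Phi^N|}{\sqrt N}+\frac{\sigma}{\sqrt N}\,\Phi^{-1}(1-\alpha)\right)\right)\le\alpha .$$ -/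

import Mathlib

open MeasureTheory ProbabilityTheory Filter Topology
open scoped ENNReal

/-- `[0,1]^d` as a subset of Euclidean space. -/
def unitCubeSet (d : ℕ) : Set (EuclideanSpace ℝ (Fin d)) :=
  {x | ∀ i, x i ∈ Set.Icc (0 : ℝ) 1}

/-- `[0,1]^d` with the Euclidean metric and its Borel σ-algebra. -/
abbrev UnitCube (d : ℕ) : Type := ↥(unitCubeSet d)

theorem isClosed_unitCubeSet (d : ℕ) : IsClosed (unitCubeSet d) := by
  have h : unitCubeSet d
      = ⋂ i : Fin d, (fun x : EuclideanSpace ℝ (Fin d) => x i) ⁻¹' Set.Icc (0 : ℝ) 1 := by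
    ext x
    simp [unitCubeSet]
  rw [h]
  exact isClosed_iInter fun i => isClosed_Icc.preimage (by fun_prop)

instance instStandardBorelUnitCube (d : ℕ) : StandardBorelSpace (UnitCube d) :=
  (isClosed_unitCubeSet d).measurableSet.standardBorel

instance instNonemptyUnitCube (d : ℕ) : Nonempty (UnitCube d) :=
  ⟨⟨0, fun i => by simp⟩⟩

section Wasserstein

variable {X : Type*} [MetricSpace X] [MeasurableSpace X]

/-- `γ` is a coupling of `μ` and `ν`: its first and second marginals are `μ` and `ν`. -/
def IsCouplingOf (γ : Measure (X × X)) (μ ν : Measure X) : Prop :=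
  γ.fst = μ ∧ γ.snd = ν

/-- The (first order) Wasserstein distance
`W(μ, ν) = inf {∫ d(x, y) γ(dx, dy) : γ a coupling of μ and ν}`, with values in `[0, ∞]`. -/
noncomputable def wassersteinDist (μ ν : Measure X) : ℝ≥0∞ :=
  ⨅ (γ : Measure (X × X)) (_ : IsCouplingOf γ μ ν), ∫⁻ p, edist p.1 p.2 ∂γ

/-- The Wasserstein correlation coefficient
`(∫ W(π_{x₁}, π₂) π₁(dx₁)) / (∫ ∫ d(y, z) π₂(dy) π₂(dz))`,
where `π₁, π₂` are the marginals of `π` and `x₁ ↦ π_{x₁}` is its disintegration with respect to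
the first coordinate. (If the denominator vanishes, the value is `0`.) -/
noncomputable def wassersteinCorr [StandardBorelSpace X] [Nonempty X]
    (π : Measure (X × X)) [IsFiniteMeasure π] : ℝ :=
  (∫⁻ x, wassersteinDist (π.condKernel x) π.snd ∂π.fst).toReal
    / (∫⁻ y, ∫⁻ z, edist y z ∂π.snd ∂π.snd).toReal

end Wasserstein

/-- `G` is a cube with centre `c` (with faces parallel to the coordinate hyperplanes and side
length `s > 0`) inside `[0,1]^d`: it is a Borel set which contains the open cube and is contained
in the closed cube, so it may contain any part of its boundary. The first inclusion entails that
the open cube, taken in `ℝ^d`, lies in `[0,1]^d`. -/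
def IsCubeWithCentre {d : ℕ} (G : Set (UnitCube d)) (c : UnitCube d) : Prop :=
  MeasurableSet G ∧ ∃ s : ℝ, 0 < s ∧
    {x : EuclideanSpace ℝ (Fin d) | ∀ i, |x i - c.1 i| < s / 2} ⊆ Subtype.val '' G ∧
    Subtype.val '' G ⊆ {x : EuclideanSpace ℝ (Fin d) | ∀ i, |x i - c.1 i| ≤ s / 2}

/-- `φ` is the map belonging to a partition of `[0,1]^d` into finitely many disjoint cubes which
sends every cube to its centre; the cubes of the partition are the fibres of `φ`. -/
structure IsCubeCentreMap {d : ℕ} (φ : UnitCube d → UnitCube d) : Prop where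
  finite_range : (Set.range φ).Finite
  isCube_fibre : ∀ c ∈ Set.range φ, IsCubeWithCentre (φ ⁻¹' {c}) c

/-- The partition of `[0,1]^d` into the fibres of `φ`. -/
def cubeCells {d : ℕ} (φ : UnitCube d → UnitCube d) : Set (Set (UnitCube d)) :=
  {G | ∃ c ∈ Set.range φ, G = φ ⁻¹' {c}}

/-- The adapted empirical measure `(1/N) ∑_{n < N} δ_{(φ (x n).1, φ (x n).2)}` of the first `N`
points of the sequence `x` (the zero measure for `N = 0`). -/
noncomputable def adaptedEmpirical {d : ℕ} (φ : UnitCube d → UnitCube d) (N : ℕ)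
    (x : ℕ → UnitCube d × UnitCube d) : Measure (UnitCube d × UnitCube d) :=
  (N : ℝ≥0∞)⁻¹ • ∑ n ∈ Finset.range N, Measure.dirac (φ (x n).1, φ (x n).2)

instance instIsFiniteMeasureAdaptedEmpirical {d : ℕ} (φ : UnitCube d → UnitCube d) (N : ℕ)
    (x : ℕ → UnitCube d × UnitCube d) : IsFiniteMeasure (adaptedEmpirical φ N x) := by
  unfold adaptedEmpirical
  rcases Nat.eq_zero_or_pos N with rfl | hN
  · simpa using (inferInstance : IsFiniteMeasure (0 : Measure (UnitCube d × UnitCube d)))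
  · refine Measure.smul_finite _ ?_
    exact ENNReal.inv_ne_top.2 (by exact_mod_cast hN.ne')

/-- The quantile function `p ↦ inf {t : p ≤ P(Z ≤ t)}`, `0 < p < 1`, of a standard normal `Z`. -/
noncomputable def stdNormalQuantile (p : ℝ) : ℝ :=
  sInf {t : ℝ | p ≤ cdf (gaussianReal 0 1) t}

/-!
The denominator of the Wasserstein correlation coefficient of the adapted empirical measure is
bounded away from `0` with probability tending to `1`: as `ν` is non-atomic, there are two sets of
positive mass at positive distance, and their empirical masses obey the law of large numbers
(`exists_tendsto_measureReal_wassersteinCorrDen_lt`).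

The threshold is of order `m / √N`, where `m` is the number of cells. Since the partitions become
arbitrarily fine and the cube is infinite, `m` tends to infinity, and the term with the normal
quantile, which is `O(1 / √N)`, is negligible. A bound of the Wasserstein distance by the diameter
times the total variation distance would show that the numerator is of the order `m / √N` as well.
The point of the proof is that it is in fact of smaller order: the mean of the numerator is
`o(m / √N)`. To see this, fix a division of the cube into `K` sets of diameter at most `ε`, and
transport one measure to the other first inside these sets, at cost `ε`, and only then across them,
at cost at most the diameter `D` of the cube (`wassersteinDist_atomicMeasure_le`). The first part
costs at most `ε` times the `L¹` independence statistic of the `m × m` contingency table of the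
sample, the second at most `D` times that of the `m × K` table. Under independence, a second moment
computation and the Cauchy–Schwarz inequality bound the mean of the statistic of a table with `a`
rows and `b` columns by `2 √(a b / N)` (`exists_indepStat_le`). Altogether the mean of the numerator
is at most `2 (ε + D √(K / m)) m / √N`, and `ε` is arbitrary.

By Markov's inequality, the rejection probability tends to `0` for every positive constant in front
of the threshold (`tendsto_measureReal_wassersteinCorr_gt`); so the test is conservative, and its
asymptotic level is bounded by every `α > 0`.
-/

/-! ### Transport plans between finitely supported measures -/

/-- If in every cell `k` of `ℓ` the fraction `min (A k) (B k) / A k` of the mass `a` is removed,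
the excess of `A k` over `B k` is left. Where `A k = 0`, the fraction is `0`, as it should be. -/
theorem sum_fiber_unmatched {ι κ : Type*} [Fintype ι] [DecidableEq κ] (ℓ : ι → κ) (a : ι → ℝ)
    (A B : κ → ℝ) (hA : ∀ k, A k = ∑ i with ℓ i = k, a i) (hB : ∀ k, 0 ≤ B k) (k : κ) :
    ∑ i with ℓ i = k, (a i - min (A (ℓ i)) (B (ℓ i)) / A (ℓ i) * a i) = max (A k - B k) 0 := by
  have h1 : ∑ i with ℓ i = k, (a i - min (A (ℓ i)) (B (ℓ i)) / A (ℓ i) * a i)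
      = ∑ i with ℓ i = k, (a i - min (A k) (B k) / A k * a i) := by
    refine Finset.sum_congr rfl fun i hi => ?_
    rw [(Finset.mem_filter.1 hi).2]
  rw [h1, Finset.sum_sub_distrib, ← Finset.mul_sum, ← hA]
  rcases eq_or_ne (A k) 0 with h0 | h0
  · have := hB k
    simp [h0, this]
  · rw [div_mul_cancel₀ _ h0]
    rcases le_total (A k) (B k) with h | h
    · rw [min_eq_left h, max_eq_right (by linarith), sub_self]
    · rw [min_eq_right h, max_eq_left (by linarith)]

/-- The total mass which the plan of `exists_partial_plan` moves away from `i`. -/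
theorem sum_matched {ι κ : Type*} [Fintype ι] [DecidableEq κ] (ℓ : ι → κ) (b : ι → ℝ)
    (A B : κ → ℝ) (hA : ∀ k, 0 ≤ A k) (hB : ∀ k, B k = ∑ i with ℓ i = k, b i) (i : ι) (x : ℝ) :
    ∑ j, (if ℓ j = ℓ i then min (A (ℓ i)) (B (ℓ i)) / (A (ℓ i) * B (ℓ i)) * x * b j else 0)
      = min (A (ℓ i)) (B (ℓ i)) / A (ℓ i) * x := by
  rw [← Finset.sum_filter, ← Finset.mul_sum, ← hB]
  rcases eq_or_ne (B (ℓ i)) 0 with h0 | h0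
  · simp [h0, hA (ℓ i)]
  · rcases eq_or_ne (A (ℓ i)) 0 with h1 | h1
    · simp [h1]
    · field_simp

/-- Two mass distributions can be matched inside the cells of `ℓ` as far as the masses of the
cells allow: the plan `w` moves mass only inside cells, and in each cell only the excess of one
distribution over the other, `a'` or `b'`, remains unmatched. -/
theorem exists_partial_plan {ι κ : Type*} [Fintype ι] [DecidableEq κ] (ℓ : ι → κ) (a b : ι → ℝ)
    (ha : ∀ i, 0 ≤ a i) (hb : ∀ i, 0 ≤ b i) :
    ∃ (w : ι → ι → ℝ) (a' b' : ι → ℝ), (∀ i j, 0 ≤ w i j) ∧ (∀ i, 0 ≤ a' i) ∧ (∀ i, 0 ≤ b' i) ∧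
      (∀ i, ∑ j, w i j + a' i = a i) ∧ (∀ j, ∑ i, w i j + b' j = b j) ∧
      (∀ i j, ℓ i ≠ ℓ j → w i j = 0) ∧
      (∀ k, ∑ i with ℓ i = k, a' i
        = max (∑ i with ℓ i = k, a i - ∑ i with ℓ i = k, b i) 0) ∧
      (∀ k, ∑ i with ℓ i = k, b' i
        = max (∑ i with ℓ i = k, b i - ∑ i with ℓ i = k, a i) 0) := by
  set A : κ → ℝ := fun k => ∑ i with ℓ i = k, a i with hA
  set B : κ → ℝ := fun k => ∑ i with ℓ i = k, b i with hB
  have hA0 : ∀ k, 0 ≤ A k := fun k => Finset.sum_nonneg fun i _ => ha i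
  have hB0 : ∀ k, 0 ≤ B k := fun k => Finset.sum_nonneg fun i _ => hb i
  have thin : ∀ (x : ℝ) (p q : ℝ), 0 ≤ x → 0 ≤ p → min p q / p * x ≤ x := by
    intro x p q hx hp
    have : min p q / p ≤ 1 := div_le_one_of_le₀ (min_le_left _ _) hp
    nlinarith
  refine ⟨fun i j => if ℓ j = ℓ i then
      min (A (ℓ i)) (B (ℓ i)) / (A (ℓ i) * B (ℓ i)) * a i * b j else 0,
    fun i => a i - min (A (ℓ i)) (B (ℓ i)) / A (ℓ i) * a i,
    fun i => b i - min (B (ℓ i)) (A (ℓ i)) / B (ℓ i) * b i, ?_, ?_, ?_, ?_, ?_, ?_, ?_, ?_⟩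
  · intro i j
    dsimp only
    split_ifs
    · exact mul_nonneg (mul_nonneg (div_nonneg (le_min (hA0 _) (hB0 _))
        (mul_nonneg (hA0 _) (hB0 _))) (ha i)) (hb j)
    · exact le_rfl
  · exact fun i => sub_nonneg.2 (thin _ _ _ (ha i) (hA0 _))
  · exact fun i => sub_nonneg.2 (thin _ _ _ (hb i) (hB0 _))
  · intro i
    rw [sum_matched ℓ b A B hA0 (fun k => rfl) i (a i)]
    ring
  · intro j
    have : ∀ i, (if ℓ j = ℓ i then
        min (A (ℓ i)) (B (ℓ i)) / (A (ℓ i) * B (ℓ i)) * a i * b j else 0)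
        = if ℓ i = ℓ j then
        min (B (ℓ j)) (A (ℓ j)) / (B (ℓ j) * A (ℓ j)) * b j * a i else 0 := by
      intro i
      by_cases h : ℓ i = ℓ j
      · rw [if_pos h.symm, if_pos h, h, min_comm, mul_comm (A _)]
        ring
      · rw [if_neg (fun h' => h h'.symm), if_neg h]
    rw [Finset.sum_congr rfl fun i _ => this i,
      sum_matched ℓ a B A hB0 (fun k => rfl) j (b j)]
    ring
  · intro i j h
    exact if_neg fun h' => h h'.symm
  · exact fun k => sum_fiber_unmatched ℓ a A B (fun _ => rfl) hB0 k
  · exact fun k => sum_fiber_unmatched ℓ b B A (fun _ => rfl) hA0 k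

/-- Two probability vectors have a transport plan which leaves the common mass in place, moves the
rest inside the cells of `ℓ` as far as possible, and only what then remains across cells. -/
theorem exists_plan_cost_le {ι κ : Type*} [Fintype ι] [DecidableEq ι] [Fintype κ] [DecidableEq κ]
    (ℓ : ι → κ) (a b : ι → ℝ) (ha : ∀ i, 0 ≤ a i) (hb : ∀ i, 0 ≤ b i)
    (hab : ∑ i, a i = ∑ i, b i) (c : ι → ι → ℝ) (hc : ∀ i, c i i = 0) (ε D : ℝ) (hε : 0 ≤ ε)
    (hD : 0 ≤ D) (hcε : ∀ i j, ℓ i = ℓ j → c i j ≤ ε) (hcD : ∀ i j, c i j ≤ D) :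
    ∃ w : ι → ι → ℝ, (∀ i j, 0 ≤ w i j) ∧ (∀ i, ∑ j, w i j = a i) ∧ (∀ j, ∑ i, w i j = b j) ∧
      ∑ i, ∑ j, w i j * c i j
        ≤ ε * ∑ i, |a i - b i| + D * ∑ k, |∑ i with ℓ i = k, (a i - b i)| := by
  -- Three rounds of matching: at single points, inside the cells of `ℓ`, and in the whole space.
  obtain ⟨w₁, a₁, b₁, hw₁, ha₁, hb₁, hwa₁, hwb₁, hd₁, hA₁, hB₁⟩ :=
    exists_partial_plan (id : ι → ι) a b ha hb
  obtain ⟨w₂, a₂, b₂, hw₂, ha₂, hb₂, hwa₂, hwb₂, hd₂, hA₂, hB₂⟩ :=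
    exists_partial_plan ℓ a₁ b₁ ha₁ hb₁
  obtain ⟨w₃, a₃, b₃, hw₃, ha₃, hb₃, hwa₃, hwb₃, -, hA₃, hB₃⟩ :=
    exists_partial_plan (fun _ : ι => ()) a₂ b₂ ha₂ hb₂
  have e1 : ∀ i, a₁ i = max (a i - b i) 0 := fun i => by
    have := hA₁ i
    simpa [Finset.sum_filter] using this
  have e1' : ∀ i, b₁ i = max (b i - a i) 0 := fun i => by
    have := hB₁ i
    simpa [Finset.sum_filter] using this
  -- The first round does not change the difference, so the second leaves in the cells exactly the
  -- excess of one of the original distributions over the other.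
  have e2 : ∀ i, a₁ i - b₁ i = a i - b i := fun i => by
    rw [e1, e1']
    rcases le_total (a i) (b i) with h | h
    · rw [max_eq_right (by linarith), max_eq_left (by linarith)]; ring
    · rw [max_eq_left (by linarith), max_eq_right (by linarith)]; ring
  have tot : ∀ (w : ι → ι → ℝ) (x x' : ι → ℝ), (∀ i, ∑ j, w i j + x' i = x i) →
      ∑ i, ∑ j, w i j + ∑ i, x' i = ∑ i, x i := fun w x x' h => by
    rw [← Finset.sum_add_distrib]
    exact Finset.sum_congr rfl fun i _ => h i
  have tot' : ∀ (w : ι → ι → ℝ) (x x' : ι → ℝ), (∀ j, ∑ i, w i j + x' j = x j) →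
      ∑ i, ∑ j, w i j + ∑ i, x' i = ∑ i, x i := fun w x x' h => by
    rw [Finset.sum_comm, ← Finset.sum_add_distrib]
    exact Finset.sum_congr rfl fun i _ => h i
  have m1 := tot _ _ _ hwa₁
  have m1' := tot' _ _ _ hwb₁
  have m2 := tot _ _ _ hwa₂
  have m2' := tot' _ _ _ hwb₂
  have m3 := tot _ _ _ hwa₃
  have z3 : ∑ i, a₃ i = 0 := by
    have := hA₃ ()
    simp only [Finset.filter_true] at this
    rw [this]
    exact max_eq_right (by linarith)
  have z3' : ∑ i, b₃ i = 0 := by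
    have := hB₃ ()
    simp only [Finset.filter_true] at this
    rw [this]
    exact max_eq_right (by linarith)
  have a₃0 : ∀ i, a₃ i = 0 := fun i =>
    (Finset.sum_eq_zero_iff_of_nonneg fun i _ => ha₃ i).1 z3 i (Finset.mem_univ i)
  have b₃0 : ∀ i, b₃ i = 0 := fun i =>
    (Finset.sum_eq_zero_iff_of_nonneg fun i _ => hb₃ i).1 z3' i (Finset.mem_univ i)
  refine ⟨fun i j => w₁ i j + w₂ i j + w₃ i j,
    fun i j => add_nonneg (add_nonneg (hw₁ i j) (hw₂ i j)) (hw₃ i j), fun i => ?_, fun j => ?_, ?_⟩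
  · rw [Finset.sum_add_distrib, Finset.sum_add_distrib]
    linarith [hwa₁ i, hwa₂ i, hwa₃ i, a₃0 i]
  · rw [Finset.sum_add_distrib, Finset.sum_add_distrib]
    linarith [hwb₁ j, hwb₂ j, hwb₃ j, b₃0 j]
  · have hle : ∀ i j, (w₁ i j + w₂ i j + w₃ i j) * c i j ≤ ε * w₂ i j + D * w₃ i j := by
      intro i j
      have h1 : w₁ i j * c i j = 0 := by
        by_cases h : i = j
        · rw [h, hc, mul_zero]
        · rw [hd₁ i j h, zero_mul]
      have h2 : w₂ i j * c i j ≤ ε * w₂ i j := by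
        by_cases h : ℓ i = ℓ j
        · nlinarith [hw₂ i j, hcε i j h]
        · rw [hd₂ i j h]; simp
      have h3 : w₃ i j * c i j ≤ D * w₃ i j := by
        nlinarith [hw₃ i j, hcD i j]
      linarith
    have h4 : ∑ i, ∑ j, w₂ i j ≤ ∑ i, |a i - b i| := by
      have h5 : ∑ i, a₁ i ≤ ∑ i, |a i - b i| := Finset.sum_le_sum fun i _ => by
        rw [e1]
        exact max_le (le_abs_self _) (abs_nonneg _)
      linarith [Finset.sum_nonneg fun i (_ : i ∈ Finset.univ) => ha₂ i]
    have h6 : ∑ i, ∑ j, w₃ i j ≤ ∑ k, |∑ i with ℓ i = k, (a i - b i)| := by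
      have h7 : ∑ i, a₂ i = ∑ k, ∑ i with ℓ i = k, a₂ i :=
        (Finset.sum_fiberwise _ _ _).symm
      have h8 : ∑ i, a₂ i ≤ ∑ k, |∑ i with ℓ i = k, (a i - b i)| := by
        rw [h7]
        refine Finset.sum_le_sum fun k _ => ?_
        rw [hA₂, ← Finset.sum_sub_distrib, Finset.sum_congr rfl fun i _ => e2 i]
        exact max_le (le_abs_self _) (abs_nonneg _)
      linarith
    calc ∑ i, ∑ j, (w₁ i j + w₂ i j + w₃ i j) * c i j
        ≤ ∑ i, ∑ j, (ε * w₂ i j + D * w₃ i j) :=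
          Finset.sum_le_sum fun i _ => Finset.sum_le_sum fun j _ => hle i j
      _ = ε * ∑ i, ∑ j, w₂ i j + D * ∑ i, ∑ j, w₃ i j := by
          simp only [Finset.sum_add_distrib, Finset.mul_sum]
      _ ≤ _ := add_le_add (mul_le_mul_of_nonneg_left h4 hε) (mul_le_mul_of_nonneg_left h6 hD)

section Discrete

variable {X : Type*} [MetricSpace X] [MeasurableSpace X] {ι : Type*} [Fintype ι]

/-- The measure `∑ i, a i • δ_(z i)`. -/
noncomputable def atomicMeasure {Y : Type*} [MeasurableSpace Y] (z : ι → Y) (a : ι → ℝ) :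
    Measure Y :=
  ∑ i, ENNReal.ofReal (a i) • Measure.dirac (z i)

theorem atomicMeasure_apply {Y : Type*} [MeasurableSpace Y] (z : ι → Y) (a : ι → ℝ) {s : Set Y}
    (hs : MeasurableSet s) :
    atomicMeasure z a s = ∑ i, ENNReal.ofReal (a i) * s.indicator 1 (z i) := by
  simp [atomicMeasure, hs]

theorem lintegral_atomicMeasure {Y : Type*} [MeasurableSpace Y] [MeasurableSingletonClass Y]
    (z : ι → Y) (a : ι → ℝ) (f : Y → ℝ≥0∞) :
    ∫⁻ y, f y ∂(atomicMeasure z a) = ∑ i, ENNReal.ofReal (a i) * f (z i) := by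
  simp [atomicMeasure]

theorem map_atomicMeasure {Y Z : Type*} [MeasurableSpace Y] [MeasurableSpace Z] (z : ι → Y)
    (a : ι → ℝ) {g : Y → Z} (hg : Measurable g) :
    (atomicMeasure z a).map g = atomicMeasure (g ∘ z) a := by
  ext s hs
  rw [Measure.map_apply hg hs, atomicMeasure_apply _ _ (hg hs), atomicMeasure_apply _ _ hs]
  rfl

theorem atomicMeasure_fst {Y Z : Type*} [MeasurableSpace Y] [MeasurableSpace Z] {κ : Type*}
    [Fintype κ] (z : ι → Y) (y : κ → Z) (w : ι → κ → ℝ) (hw : ∀ i j, 0 ≤ w i j) :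
    (atomicMeasure (fun p : ι × κ => (z p.1, y p.2)) fun p => w p.1 p.2).fst
      = atomicMeasure z fun i => ∑ j, w i j := by
  rw [Measure.fst, map_atomicMeasure _ _ measurable_fst]
  ext s hs
  rw [atomicMeasure_apply _ _ hs, atomicMeasure_apply _ _ hs, Fintype.sum_prod_type]
  refine Finset.sum_congr rfl fun i _ => ?_
  rw [ENNReal.ofReal_sum_of_nonneg fun j _ => hw i j, Finset.sum_mul]
  rfl

theorem atomicMeasure_snd {Y Z : Type*} [MeasurableSpace Y] [MeasurableSpace Z] {κ : Type*}
    [Fintype κ] (z : ι → Y) (y : κ → Z) (w : ι → κ → ℝ) (hw : ∀ i j, 0 ≤ w i j) :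
    (atomicMeasure (fun p : ι × κ => (z p.1, y p.2)) fun p => w p.1 p.2).snd
      = atomicMeasure y fun j => ∑ i, w i j := by
  rw [Measure.snd, map_atomicMeasure _ _ measurable_snd]
  ext s hs
  rw [atomicMeasure_apply _ _ hs, atomicMeasure_apply _ _ hs, Fintype.sum_prod_type_right]
  refine Finset.sum_congr rfl fun i _ => ?_
  rw [ENNReal.ofReal_sum_of_nonneg fun j _ => hw j i, Finset.sum_mul]
  rfl

/-- A two-scale bound for the Wasserstein distance: differences of the masses of single points
cost at most the diameter `ε` of the cells of `ℓ`, and only differences of the masses of whole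
cells cost the diameter `D` of the space. -/
theorem wassersteinDist_atomicMeasure_le [MeasurableSingletonClass X] {κ : Type*} [Fintype κ]
    [DecidableEq κ] (z : ι → X) (ℓ : ι → κ) (a b : ι → ℝ)
    (ha : ∀ i, 0 ≤ a i) (hb : ∀ i, 0 ≤ b i) (hab : ∑ i, a i = ∑ i, b i) (ε D : ℝ) (hε : 0 ≤ ε)
    (hD : 0 ≤ D) (hzε : ∀ i j, ℓ i = ℓ j → dist (z i) (z j) ≤ ε)
    (hzD : ∀ i j, dist (z i) (z j) ≤ D) :
    wassersteinDist (atomicMeasure z a) (atomicMeasure z b)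
      ≤ ENNReal.ofReal (ε * ∑ i, |a i - b i| + D * ∑ k, |∑ i with ℓ i = k, (a i - b i)|) := by
  classical
  obtain ⟨w, hw, hwa, hwb, hcost⟩ := exists_plan_cost_le ℓ a b ha hb hab
    (fun i j => dist (z i) (z j)) (fun i => dist_self _) ε D hε hD hzε hzD
  refine (iInf₂_le (atomicMeasure (fun p : ι × ι => (z p.1, z p.2)) fun p => w p.1 p.2)
    ⟨?fst, ?snd⟩).trans ?cost
  case fst =>
    rw [atomicMeasure_fst _ _ _ hw]
    simp only [hwa]
  case snd =>
    rw [atomicMeasure_snd _ _ _ hw]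
    simp only [hwb]
  case cost =>
    rw [lintegral_atomicMeasure]
    refine le_trans (le_of_eq ?_) (ENNReal.ofReal_le_ofReal hcost)
    rw [← Fintype.sum_prod_type (f := fun p : ι × ι => w p.1 p.2 * dist (z p.1) (z p.2)),
      ENNReal.ofReal_sum_of_nonneg fun p _ => mul_nonneg (hw _ _) dist_nonneg]
    refine Finset.sum_congr rfl fun p _ => ?_
    rw [ENNReal.ofReal_mul (hw _ _), edist_dist]

/-- The disintegration of a finitely supported measure at an atom of its first marginal. -/
theorem condKernel_atomicMeasure {Y Z : Type*} [MeasurableSpace Y] [MeasurableSpace Z]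
    [MeasurableSingletonClass Y] [StandardBorelSpace Z] [Nonempty Z] {κ : Type*} [Fintype κ]
    (z : ι → Y) (hz : Function.Injective z) (y : κ → Z) (r : ι → κ → ℝ) (hr : ∀ i j, 0 ≤ r i j)
    (ρ : Measure (Y × Z)) [IsFiniteMeasure ρ]
    (hρ : ρ = atomicMeasure (fun p : ι × κ => (z p.1, y p.2)) fun p => r p.1 p.2)
    (i : ι) (hi : 0 < ∑ j, r i j) :
    ρ.condKernel (z i) = atomicMeasure y fun j => r i j / ∑ j, r i j := by
  classical
  have hfst : ρ.fst {z i} = ENNReal.ofReal (∑ j, r i j) := by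
    rw [hρ, atomicMeasure_fst _ _ _ hr, atomicMeasure_apply _ _ (measurableSet_singleton _),
      Finset.sum_eq_single i]
    · simp
    · intro i' _ h
      simp [hz.ne h]
    · simp
  ext s hs
  rw [Measure.condKernel_apply_of_ne_zero (by rw [hfst]; simpa using hi), hfst, hρ,
    atomicMeasure_apply _ _ ((measurableSet_singleton _).prod hs), atomicMeasure_apply _ _ hs,
    Fintype.sum_prod_type, Finset.sum_eq_single i]
  · rw [Finset.mul_sum]
    refine Finset.sum_congr rfl fun j _ => ?_
    rw [ENNReal.ofReal_div_of_pos hi, ENNReal.div_eq_inv_mul, mul_assoc]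
    congr 2
    by_cases h : y j ∈ s <;> simp [h]
  · intro i' _ h
    refine Finset.sum_eq_zero fun j _ => ?_
    simp [hz.ne h]
  · simp

/-- The numerator of the Wasserstein correlation coefficient of a finitely supported measure is
bounded by its `L¹`-distance to the product of its marginals, taken at two scales. -/
theorem lintegral_wassersteinDist_condKernel_le [StandardBorelSpace X] [Nonempty X] {κ : Type*}
    [Fintype κ] [DecidableEq κ] (z : ι → X) (hz : Function.Injective z) (ℓ : ι → κ)
    (r : ι → ι → ℝ) (hr : ∀ i j, 0 ≤ r i j) (hr1 : ∑ i, ∑ j, r i j = 1) (ε D : ℝ)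
    (hε : 0 ≤ ε) (hD : 0 ≤ D) (hzε : ∀ i j, ℓ i = ℓ j → dist (z i) (z j) ≤ ε)
    (hzD : ∀ i j, dist (z i) (z j) ≤ D) (ρ : Measure (X × X)) [IsFiniteMeasure ρ]
    (hρ : ρ = atomicMeasure (fun p : ι × ι => (z p.1, z p.2)) fun p => r p.1 p.2) :
    ∫⁻ x, wassersteinDist (ρ.condKernel x) ρ.snd ∂ρ.fst
      ≤ ENNReal.ofReal (ε * ∑ i, ∑ j, |r i j - (∑ j', r i j') * ∑ i', r i' j|
        + D * ∑ i, ∑ k, |∑ j with ℓ j = k, (r i j - (∑ j', r i j') * ∑ i', r i' j)|) := by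
  have hfst : ρ.fst = atomicMeasure z fun i => ∑ j, r i j := by rw [hρ, atomicMeasure_fst _ _ _ hr]
  have hsnd : ρ.snd = atomicMeasure z fun j => ∑ i, r i j := by rw [hρ, atomicMeasure_snd _ _ _ hr]
  have hs0 : ∀ i, 0 ≤ ∑ j, r i j := fun i => Finset.sum_nonneg fun j _ => hr i j
  rw [hfst, lintegral_atomicMeasure, Finset.mul_sum, Finset.mul_sum, ← Finset.sum_add_distrib,
    ENNReal.ofReal_sum_of_nonneg fun i _ => by positivity]
  refine Finset.sum_le_sum fun i _ => ?_
  rcases (hs0 i).eq_or_lt with h0 | h0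
  · simp [← h0]
  · rw [condKernel_atomicMeasure z hz z r hr ρ hρ i h0, hsnd]
    refine (mul_le_mul_right (wassersteinDist_atomicMeasure_le z ℓ _ _
      (fun j => div_nonneg (hr i j) h0.le) (fun j => Finset.sum_nonneg fun i _ => hr i j) ?_ ε D
      hε hD hzε hzD) _).trans (le_of_eq ?_)
    · rw [← Finset.sum_div, div_self h0.ne', Finset.sum_comm, hr1]
    · rw [← ENNReal.ofReal_mul h0.le]
      have key : ∀ j, (∑ j', r i j') * (r i j / (∑ j', r i j') - ∑ i', r i' j)
          = r i j - (∑ j', r i j') * ∑ i', r i' j := fun j => by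
        field_simp
      congr 1
      rw [mul_add, mul_left_comm, mul_left_comm _ D]
      congr 2
      · rw [Finset.mul_sum]
        refine Finset.sum_congr rfl fun j _ => ?_
        rw [← key, abs_mul, abs_of_pos h0]
      · rw [Finset.mul_sum]
        refine Finset.sum_congr rfl fun k _ => ?_
        rw [← Finset.sum_congr rfl fun j _ => key j, ← Finset.mul_sum, abs_mul, abs_of_pos h0]

end Discrete

/-! ### Empirical frequencies -/

section EmpFreq

variable {γ β σ τ κ : Type*} [DecidableEq γ] [DecidableEq σ] [DecidableEq τ] [DecidableEq κ]

/-- The relative frequency of `c` among `y 0, …, y (N - 1)`; it is `0` for `N = 0`. -/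
noncomputable def empFreq (N : ℕ) (y : ℕ → γ) (c : γ) : ℝ :=
  (∑ n ∈ Finset.range N, if y n = c then 1 else 0) / N

theorem empFreq_nonneg (N : ℕ) (y : ℕ → γ) (c : γ) : 0 ≤ empFreq N y c :=
  div_nonneg (Finset.sum_nonneg fun n _ => by split_ifs <;> norm_num) (Nat.cast_nonneg N)

theorem sum_empFreq [Fintype γ] {N : ℕ} (hN : 0 < N) (y : ℕ → γ) : ∑ c, empFreq N y c = 1 := by
  have hN' : (N : ℝ) ≠ 0 := by exact_mod_cast hN.ne'
  unfold empFreq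
  rw [← Finset.sum_div, Finset.sum_comm]
  simp [hN']

theorem sum_empFreq_prod_right [Fintype τ] (N : ℕ) (y : ℕ → σ) (y' : ℕ → τ) (i : σ) :
    ∑ j, empFreq N (fun n => (y n, y' n)) (i, j) = empFreq N y i := by
  unfold empFreq
  rw [← Finset.sum_div, Finset.sum_comm]
  congr 1
  refine Finset.sum_congr rfl fun n _ => ?_
  by_cases h : y n = i <;> simp [h]

theorem sum_empFreq_prod_left [Fintype σ] (N : ℕ) (y : ℕ → σ) (y' : ℕ → τ) (j : τ) :
    ∑ i, empFreq N (fun n => (y n, y' n)) (i, j) = empFreq N y' j := by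
  unfold empFreq
  rw [← Finset.sum_div, Finset.sum_comm]
  congr 1
  refine Finset.sum_congr rfl fun n _ => ?_
  by_cases h : y' n = j <;> simp [h]

theorem sum_empFreq_fiber [Fintype τ] (N : ℕ) (y' : ℕ → τ) (ℓ : τ → κ) (k : κ) :
    ∑ j with ℓ j = k, empFreq N y' j = empFreq N (fun n => ℓ (y' n)) k := by
  unfold empFreq
  rw [← Finset.sum_div, Finset.sum_comm]
  congr 1
  refine Finset.sum_congr rfl fun n _ => ?_
  rw [Finset.sum_filter, Finset.sum_eq_single (y' n)]
  · simp
  · intro j _ h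
    simp [h.symm]
  · simp

theorem sum_empFreq_prod_fiber [Fintype τ] (N : ℕ) (y : ℕ → σ) (y' : ℕ → τ) (ℓ : τ → κ) (i : σ)
    (k : κ) :
    ∑ j with ℓ j = k, empFreq N (fun n => (y n, y' n)) (i, j)
      = empFreq N (fun n => (y n, ℓ (y' n))) (i, k) := by
  unfold empFreq
  rw [← Finset.sum_div, Finset.sum_comm]
  congr 1
  refine Finset.sum_congr rfl fun n _ => ?_
  rw [Finset.sum_filter, Finset.sum_eq_single (y' n)]
  · by_cases h : y n = i <;> simp [h]
  · intro j _ h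
    simp [h.symm]
  · simp

/-- The `L¹`-distance between the joint empirical distribution of two samples and the product of
their empirical distributions. -/
noncomputable def indepStat [Fintype σ] [Fintype τ] (N : ℕ) (y : ℕ → σ) (y' : ℕ → τ) : ℝ :=
  ∑ i, ∑ j, |empFreq N (fun n => (y n, y' n)) (i, j) - empFreq N y i * empFreq N y' j|

theorem smul_sum_dirac_eq_atomicMeasure [Fintype γ] {Y : Type*} [MeasurableSpace Y] {N : ℕ}
    (hN : 0 < N) (z : γ → Y) (y : ℕ → γ) :
    (N : ℝ≥0∞)⁻¹ • ∑ n ∈ Finset.range N, Measure.dirac (z (y n))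
      = atomicMeasure z (empFreq N y) := by
  have hN' : (0 : ℝ) < N := by exact_mod_cast hN
  ext s hs
  rw [atomicMeasure_apply _ _ hs]
  have h : ∀ c, ENNReal.ofReal (empFreq N y c)
      = (N : ℝ≥0∞)⁻¹ * ∑ n ∈ Finset.range N, if y n = c then 1 else 0 := fun c => by
    rw [empFreq, ENNReal.ofReal_div_of_pos hN', ENNReal.ofReal_natCast, ENNReal.div_eq_inv_mul,
      ENNReal.ofReal_sum_of_nonneg fun n _ => by split_ifs <;> norm_num]
    congr 1
    refine Finset.sum_congr rfl fun n _ => ?_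
    split_ifs <;> simp
  simp only [h, Measure.smul_apply, Measure.finsetSum_apply, Measure.dirac_apply' _ hs,
    smul_eq_mul, mul_assoc]
  rw [← Finset.mul_sum]
  congr 1
  simp only [Finset.sum_mul]
  rw [Finset.sum_comm]
  refine Finset.sum_congr rfl fun n _ => ?_
  simp

end EmpFreq

/-! ### The empirical independence statistic of a sample with independent coordinates -/

section Expectation

variable {𝒳 𝒴 : Type*} [MeasurableSpace 𝒴]

/-- The product of the indicator of `s` and the centred indicator of `t`. -/
noncomputable def centredIndicator (ν : Measure 𝒴) (s : Set 𝒳) (t : Set 𝒴) (x : 𝒳 × 𝒴) : ℝ :=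
  s.indicator 1 x.1 * (t.indicator 1 x.2 - ν.real t)

theorem abs_centredIndicator_le (ν : Measure 𝒴) [IsProbabilityMeasure ν] (s : Set 𝒳) (t : Set 𝒴)
    (x : 𝒳 × 𝒴) : |centredIndicator ν s t x| ≤ 1 := by
  have h0 : 0 ≤ ν.real t := measureReal_nonneg
  have h1 : ν.real t ≤ 1 := measureReal_le_one
  unfold centredIndicator
  rw [abs_le]
  constructor <;> by_cases hs : x.1 ∈ s <;> by_cases ht : x.2 ∈ t <;> simp [hs, ht] <;> linarith

theorem empFreq_sub_eq {σ : Type*} [DecidableEq σ] (ν : Measure 𝒴) {N : ℕ}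
    (hN : 0 < N) (g : 𝒴 → σ) (j : σ) (x : ℕ → 𝒳 × 𝒴) :
    empFreq N (fun n => g (x n).2) j - ν.real (g ⁻¹' {j})
      = (∑ n ∈ Finset.range N, centredIndicator ν Set.univ (g ⁻¹' {j}) (x n)) / N := by
  have hN' : (N : ℝ) ≠ 0 := by exact_mod_cast hN.ne'
  have h : ∀ n, centredIndicator ν Set.univ (g ⁻¹' {j}) (x n)
      = (if g (x n).2 = j then 1 else 0) - ν.real (g ⁻¹' {j}) := fun n => by
    by_cases h : g (x n).2 = j <;> simp [centredIndicator, h]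
  simp only [h, Finset.sum_sub_distrib, sub_div, empFreq]
  simp [hN']

theorem empFreq_prod_sub_eq {σ τ : Type*} [DecidableEq σ] [DecidableEq τ] (ν : Measure 𝒴) (N : ℕ)
    (f : 𝒳 → σ) (g : 𝒴 → τ) (i : σ) (j : τ) (x : ℕ → 𝒳 × 𝒴) :
    empFreq N (fun n => (f (x n).1, g (x n).2)) (i, j)
        - empFreq N (fun n => f (x n).1) i * ν.real (g ⁻¹' {j})
      = (∑ n ∈ Finset.range N, centredIndicator ν (f ⁻¹' {i}) (g ⁻¹' {j}) (x n)) / N := by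
  have h : ∀ n, centredIndicator ν (f ⁻¹' {i}) (g ⁻¹' {j}) (x n)
      = (if (f (x n).1, g (x n).2) = (i, j) then 1 else 0)
        - (if f (x n).1 = i then 1 else 0) * ν.real (g ⁻¹' {j}) := fun n => by
    by_cases h : f (x n).1 = i <;> by_cases h' : g (x n).2 = j <;> simp [centredIndicator, h, h']
  simp only [h, Finset.sum_sub_distrib, sub_div, empFreq, ← Finset.sum_mul]
  ring

variable [MeasurableSpace 𝒳]

theorem measurable_centredIndicator (ν : Measure 𝒴) {s : Set 𝒳} {t : Set 𝒴}
    (hs : MeasurableSet s) (ht : MeasurableSet t) : Measurable (centredIndicator ν s t) := by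
  unfold centredIndicator
  have h1 : Measurable (s.indicator (1 : 𝒳 → ℝ)) := measurable_one.indicator hs
  have h2 : Measurable (t.indicator (1 : 𝒴 → ℝ)) := measurable_one.indicator ht
  fun_prop

theorem integral_centredIndicator (μ : Measure 𝒳) (ν : Measure 𝒴) [IsProbabilityMeasure μ]
    [IsProbabilityMeasure ν] (s : Set 𝒳) {t : Set 𝒴} (ht : MeasurableSet t) :
    ∫ x, centredIndicator ν s t x ∂(μ.prod ν) = 0 := by
  have hi : Integrable (t.indicator (1 : 𝒴 → ℝ)) ν := (integrable_const (1 : ℝ)).indicator ht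
  unfold centredIndicator
  rw [integral_prod_mul (f := fun x => s.indicator (1 : 𝒳 → ℝ) x)
      (g := fun y => t.indicator (1 : 𝒴 → ℝ) y - ν.real t),
    integral_sub hi (integrable_const _),
    integral_indicator_one ht]
  simp

theorem integral_centredIndicator_sq_le (μ : Measure 𝒳) (ν : Measure 𝒴) [IsProbabilityMeasure μ]
    [IsProbabilityMeasure ν] {s : Set 𝒳} {t : Set 𝒴} (hs : MeasurableSet s)
    (ht : MeasurableSet t) :
    ∫ x, centredIndicator ν s t x ^ 2 ∂(μ.prod ν) ≤ μ.real s * ν.real t := by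
  have hsq : ∀ x : 𝒳 × 𝒴, centredIndicator ν s t x ^ 2
      = s.indicator (1 : 𝒳 → ℝ) x.1
        * ((1 - 2 * ν.real t) * t.indicator (1 : 𝒴 → ℝ) x.2 + ν.real t ^ 2) := fun x => by
    unfold centredIndicator
    by_cases hs : x.1 ∈ s <;> by_cases ht : x.2 ∈ t <;> simp [hs, ht]
    ring
  have hi : Integrable (t.indicator (1 : 𝒴 → ℝ)) ν := (integrable_const (1 : ℝ)).indicator ht
  simp only [hsq]
  rw [integral_prod_mul (f := fun x => s.indicator (1 : 𝒳 → ℝ) x)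
      (g := fun y => (1 - 2 * ν.real t) * t.indicator (1 : 𝒴 → ℝ) y + ν.real t ^ 2),
    integral_add (hi.const_mul _) (integrable_const _),
    integral_const_mul, integral_indicator_one ht, integral_indicator_one hs]
  have h0 : 0 ≤ μ.real s := measureReal_nonneg
  refine mul_le_mul_of_nonneg_left ?_ h0
  simp
  nlinarith [sq_nonneg (ν.real t)]

theorem sum_measureReal_fiber {σ : Type*} [Fintype σ] (μ : Measure 𝒳)
    [IsProbabilityMeasure μ] (f : 𝒳 → σ)
    (hf : ∀ i, MeasurableSet (f ⁻¹' {i})) : ∑ i, μ.real (f ⁻¹' {i}) = 1 := by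
  rw [← measureReal_iUnion_fintype (fun i j hij => ?_) hf]
  · rw [← Set.preimage_iUnion, Set.iUnion_of_singleton, Set.preimage_univ, probReal_univ]
  · exact Disjoint.preimage _ (by simpa using hij)

theorem sum_sqrt_le_sqrt_card_mul {ι : Type*} [Fintype ι] (p : ι → ℝ) (hp : ∀ i, 0 ≤ p i) :
    ∑ i, √(p i) ≤ √(Fintype.card ι * ∑ i, p i) := by
  refine Real.le_sqrt_of_sq_le ((sq_sum_le_card_mul_sum_sq).trans (le_of_eq ?_))
  simp [Real.sq_sqrt (hp _)]

variable {μ : Measure 𝒳} {ν : Measure 𝒴} [IsProbabilityMeasure μ] [IsProbabilityMeasure ν]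
  {Ω : Type*} [MeasurableSpace Ω] {P : Measure Ω} [IsProbabilityMeasure P] {X : ℕ → Ω → 𝒳 × 𝒴}

theorem memLp_centredIndicator_comp (hX : ∀ n, Measurable (X n)) {s : Set 𝒳} {t : Set 𝒴}
    (hs : MeasurableSet s) (ht : MeasurableSet t) (n : ℕ) :
    MemLp (fun ω => centredIndicator ν s t (X n ω)) 2 P :=
  MemLp.of_bound (((measurable_centredIndicator ν hs ht).comp (hX n)).aestronglyMeasurable) 1
    (ae_of_all _ fun ω => abs_centredIndicator_le ν s t (X n ω))

/-- The summands are centred and pairwise independent with variance at most `μ s * ν t`. -/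
theorem integral_abs_sum_centredIndicator_le (hX : ∀ n, Measurable (X n))
    (hlaw : ∀ n, P.map (X n) = μ.prod ν) (hind : iIndepFun X P) (N : ℕ) {s : Set 𝒳} {t : Set 𝒴}
    (hs : MeasurableSet s) (ht : MeasurableSet t) :
    ∫ ω, |(∑ n ∈ Finset.range N, centredIndicator ν s t (X n ω)) / N| ∂P
      ≤ √(μ.real s * ν.real t / N) := by
  have hm := measurable_centredIndicator ν hs ht
  set h := centredIndicator ν s t with hh
  have hL : ∀ n, MemLp (fun ω => h (X n ω)) 2 P := memLp_centredIndicator_comp hX hs ht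
  have hmean : ∀ n, ∫ ω, h (X n ω) ∂P = 0 := fun n => by
    rw [← integral_map (hX n).aemeasurable hm.aestronglyMeasurable, hlaw,
      integral_centredIndicator μ ν s ht]
  have hvar : ∀ n, Var[fun ω => h (X n ω); P] ≤ μ.real s * ν.real t := fun n => by
    rw [variance_of_integral_eq_zero (hL n).aestronglyMeasurable.aemeasurable (hmean n)]
    have := integral_map (μ := P) (hX n).aemeasurable
      (f := fun x => h x ^ 2) (hm.pow_const 2).aestronglyMeasurable
    rw [hlaw] at this
    rw [← this]
    exact integral_centredIndicator_sq_le μ ν hs ht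
  set S : Ω → ℝ := ∑ n ∈ Finset.range N, fun ω => h (X n ω) with hS
  have hSL : MemLp S 2 P := memLp_finsetSum' _ fun n _ => hL n
  have hSmean : ∫ ω, S ω ∂P = 0 := by
    simp only [hS, Finset.sum_apply]
    rw [integral_finsetSum _ fun n _ => (hL n).integrable one_le_two]
    exact Finset.sum_eq_zero fun n _ => hmean n
  have hSvar : ∫ ω, S ω ^ 2 ∂P ≤ N * (μ.real s * ν.real t) := by
    rw [← variance_of_integral_eq_zero hSL.aestronglyMeasurable.aemeasurable hSmean,
      IndepFun.variance_sum (fun n _ => hL n)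
        (fun i _ j _ hij => (hind.indepFun hij).comp hm hm)]
    calc ∑ n ∈ Finset.range N, Var[fun ω => h (X n ω); P]
        ≤ ∑ n ∈ Finset.range N, μ.real s * ν.real t := Finset.sum_le_sum fun n _ => hvar n
      _ = N * (μ.real s * ν.real t) := by simp
  have hjensen : (∫ ω, |S ω| ∂P) ^ 2 ≤ ∫ ω, S ω ^ 2 ∂P := by
    have h1 := variance_eq_sub (μ := P) (X := fun ω => |S ω|) hSL.abs
    have h2 := variance_nonneg (fun ω => |S ω|) P
    have h3 : ∫ ω, ((fun ω => |S ω|) ^ 2) ω ∂P = ∫ ω, S ω ^ 2 ∂P := by simp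
    rw [h1] at h2
    linarith
  have hfun : ∀ ω, |(∑ n ∈ Finset.range N, h (X n ω)) / N| = |S ω| / N := fun ω => by
    rw [abs_div, Nat.abs_cast, hS, Finset.sum_apply]
  simp only [hfun]
  rw [integral_div]
  refine Real.le_sqrt_of_sq_le ?_
  rcases Nat.eq_zero_or_pos N with rfl | hN
  · simp
  have hN' : (0 : ℝ) < N := by exact_mod_cast hN
  rw [div_pow, div_le_div_iff₀ (by positivity) hN']
  nlinarith

/-- For a sample with independent coordinates, the empirical independence statistic has a majorant
`U` with expectation at most `2 √(|σ| |τ| / N)`. With `q j` the probability of `g = j`, it comes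
from splitting the joint frequency minus the product of the frequencies `F i`, `G j` as
`(J (i, j) - F i * q j) - F i * (G j - q j)`: both parts are centred sums, and the second one is
summed over `i` before taking expectations. -/
theorem exists_indepStat_le {σ τ : Type*} [Fintype σ] [Nonempty σ] [Fintype τ] [DecidableEq σ]
    [DecidableEq τ] (hX : ∀ n, Measurable (X n)) (hlaw : ∀ n, P.map (X n) = μ.prod ν)
    (hind : iIndepFun X P) {N : ℕ} (hN : 0 < N) (f : 𝒳 → σ) (g : 𝒴 → τ)
    (hf : ∀ i, MeasurableSet (f ⁻¹' {i})) (hg : ∀ j, MeasurableSet (g ⁻¹' {j})) :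
    ∃ U : Ω → ℝ, Integrable U P ∧
      (∀ ω, indepStat N (fun n => f (X n ω).1) (fun n => g (X n ω).2) ≤ U ω) ∧
      ∫ ω, U ω ∂P ≤ 2 * √(Fintype.card σ * Fintype.card τ / N) := by
  have hN' : (0 : ℝ) < N := by exact_mod_cast hN
  obtain ⟨E, hE⟩ : ∃ E : Set 𝒳 → Set 𝒴 → Ω → ℝ, ∀ s t ω, E s t ω
      = |(∑ n ∈ Finset.range N, centredIndicator ν s t (X n ω)) / N| := ⟨_, fun _ _ _ => rfl⟩
  have hint : ∀ {s : Set 𝒳} {t : Set 𝒴}, MeasurableSet s → MeasurableSet t →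
      Integrable (E s t) P := fun {s t} hs ht => by
    rw [funext (hE s t)]
    exact ((integrable_finsetSum _ fun n _ =>
      (memLp_centredIndicator_comp hX hs ht n).integrable one_le_two).div_const _).abs
  have hle : ∀ {s : Set 𝒳} {t : Set 𝒴}, MeasurableSet s → MeasurableSet t →
      ∫ ω, E s t ω ∂P ≤ √(μ.real s * ν.real t / N) := fun {s t} hs ht => by
    simp only [hE]
    exact integral_abs_sum_centredIndicator_le hX hlaw hind N hs ht
  have hint1 : Integrable (fun ω => ∑ i, ∑ j, E (f ⁻¹' {i}) (g ⁻¹' {j}) ω) P :=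
    integrable_finsetSum _ fun i _ => integrable_finsetSum _ fun j _ => hint (hf i) (hg j)
  have hint2 : Integrable (fun ω => ∑ j, E Set.univ (g ⁻¹' {j}) ω) P :=
    integrable_finsetSum _ fun j _ => hint MeasurableSet.univ (hg j)
  refine ⟨fun ω => ∑ i, ∑ j, E (f ⁻¹' {i}) (g ⁻¹' {j}) ω + ∑ j, E Set.univ (g ⁻¹' {j}) ω,
    hint1.add hint2, fun ω => ?_, ?_⟩
  · simp only [hE, ← empFreq_sub_eq ν hN g _ (fun n => X n ω),
      ← empFreq_prod_sub_eq ν N f g _ _ (fun n => X n ω), indepStat]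
    set F := empFreq N fun n => f (X n ω).1
    set G := empFreq N fun n => g (X n ω).2
    set J := empFreq N fun n => (f (X n ω).1, g (X n ω).2)
    have hF0 : ∀ i, 0 ≤ F i := empFreq_nonneg N _
    have hF1 : ∑ i, F i = 1 := sum_empFreq hN _
    have h1 : ∑ j, |G j - ν.real (g ⁻¹' {j})|
        = ∑ i, ∑ j, F i * |G j - ν.real (g ⁻¹' {j})| := by
      rw [← Finset.sum_mul_sum, hF1, one_mul]
    rw [h1, ← Finset.sum_add_distrib]
    refine Finset.sum_le_sum fun i _ => ?_
    rw [← Finset.sum_add_distrib]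
    refine Finset.sum_le_sum fun j _ => ?_
    have h2 : F i * |G j - ν.real (g ⁻¹' {j})| = |F i * (G j - ν.real (g ⁻¹' {j}))| := by
      rw [abs_mul, abs_of_nonneg (hF0 i)]
    rw [h2]
    have h3 : J (i, j) - F i * G j
        = (J (i, j) - F i * ν.real (g ⁻¹' {j})) - F i * (G j - ν.real (g ⁻¹' {j})) := by ring
    rw [h3]
    exact abs_sub _ _
  · rw [integral_add hint1 hint2]
    have h1 : ∫ ω, ∑ i, ∑ j, E (f ⁻¹' {i}) (g ⁻¹' {j}) ω ∂P
        ≤ √(Fintype.card σ * Fintype.card τ / N) := by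
      have h3 : ∫ ω, ∑ i, ∑ j, E (f ⁻¹' {i}) (g ⁻¹' {j}) ω ∂P
          = ∑ p : σ × τ, ∫ ω, E (f ⁻¹' {p.1}) (g ⁻¹' {p.2}) ω ∂P := by
        rw [← integral_finsetSum _ fun p _ => hint (hf p.1) (hg p.2)]
        simp only [Fintype.sum_prod_type]
      have h4 : ∑ p : σ × τ, μ.real (f ⁻¹' {p.1}) * ν.real (g ⁻¹' {p.2}) / N = 1 / N := by
        rw [← Finset.sum_div, Fintype.sum_prod_type]
        dsimp only
        rw [← Finset.sum_mul_sum, sum_measureReal_fiber μ f hf, sum_measureReal_fiber ν g hg, one_mul]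
      rw [h3]
      refine (Finset.sum_le_sum fun p _ => hle (hf p.1) (hg p.2)).trans
        ((sum_sqrt_le_sqrt_card_mul _ fun p => by positivity).trans (le_of_eq ?_))
      rw [h4, Fintype.card_prod, Nat.cast_mul, mul_one_div]
    have h2 : ∫ ω, ∑ j, E Set.univ (g ⁻¹' {j}) ω ∂P
        ≤ √(Fintype.card σ * Fintype.card τ / N) := by
      have h4 : ∑ j, μ.real Set.univ * ν.real (g ⁻¹' {j}) / N = 1 / N := by
        rw [← Finset.sum_div, ← Finset.mul_sum, sum_measureReal_fiber ν g hg, probReal_univ,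
          one_mul]
      rw [integral_finsetSum _ fun j _ => hint MeasurableSet.univ (hg j)]
      refine (Finset.sum_le_sum fun j _ => hle MeasurableSet.univ (hg j)).trans
        ((sum_sqrt_le_sqrt_card_mul _ fun j => by positivity).trans ?_)
      rw [h4, mul_one_div]
      refine Real.sqrt_le_sqrt (div_le_div_of_nonneg_right ?_ hN'.le)
      have : (1 : ℝ) ≤ Fintype.card σ := by exact_mod_cast Fintype.card_pos
      exact le_mul_of_one_le_left (Nat.cast_nonneg _) this
    linarith

end Expectation

/-! ### The Wasserstein correlation coefficient of the adapted empirical measure -/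

section Adapted

variable {d : ℕ}

/-- The numerator of `wassersteinCorr`, as a real number. -/
noncomputable def wassersteinCorrNum {X : Type*} [MetricSpace X] [MeasurableSpace X]
    [StandardBorelSpace X] [Nonempty X] (π : Measure (X × X)) [IsFiniteMeasure π] : ℝ :=
  (∫⁻ x, wassersteinDist (π.condKernel x) π.snd ∂π.fst).toReal

/-- The denominator of `wassersteinCorr`, as a real number. -/
noncomputable def wassersteinCorrDen {X : Type*} [MetricSpace X] [MeasurableSpace X]
    (π : Measure (X × X)) : ℝ :=
  (∫⁻ y, ∫⁻ z, edist y z ∂π.snd ∂π.snd).toReal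

theorem indepStat_nonneg {σ τ : Type*} [Fintype σ] [Fintype τ] [DecidableEq σ] [DecidableEq τ]
    (N : ℕ) (y : ℕ → σ) (y' : ℕ → τ) : 0 ≤ indepStat N y y' :=
  Finset.sum_nonneg fun _ _ => Finset.sum_nonneg fun _ _ => abs_nonneg _

/-- The bound of `lintegral_wassersteinDist_condKernel_le` for the adapted empirical measure. The
second term is the independence statistic with the second coordinate observed only through the
coarse label `ℓ`. -/
theorem wassersteinCorrNum_adaptedEmpirical_le (φ : UnitCube d → UnitCube d)
    [Fintype (Set.range φ)] [DecidableEq (Set.range φ)] {κ : Type*} [Fintype κ] [DecidableEq κ]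
    (ℓ : UnitCube d → κ) {ε D : ℝ} (hε : 0 ≤ ε) (hD : 0 ≤ D)
    (hℓ : ∀ x y, ℓ x = ℓ y → dist x y ≤ ε) (hdist : ∀ x y : UnitCube d, dist x y ≤ D) {N : ℕ}
    (hN : 0 < N) (x : ℕ → UnitCube d × UnitCube d) :
    wassersteinCorrNum (adaptedEmpirical φ N x)
      ≤ ε * indepStat N (fun n => Set.rangeFactorization φ (x n).1)
          (fun n => Set.rangeFactorization φ (x n).2)
        + D * indepStat N (fun n => Set.rangeFactorization φ (x n).1) (fun n => ℓ (φ (x n).2)) := by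
  set f : UnitCube d → Set.range φ := Set.rangeFactorization φ with hf
  have hρ : adaptedEmpirical φ N x
      = atomicMeasure (fun p : Set.range φ × Set.range φ => ((p.1 : UnitCube d), (p.2 : UnitCube d)))
          fun p => empFreq N (fun n => (f (x n).1, f (x n).2)) (p.1, p.2) :=
    smul_sum_dirac_eq_atomicMeasure hN
      (fun p : Set.range φ × Set.range φ => ((p.1 : UnitCube d), (p.2 : UnitCube d)))
      (fun n => (f (x n).1, f (x n).2))
  have h := lintegral_wassersteinDist_condKernel_le (Subtype.val : Set.range φ → UnitCube d)
    Subtype.val_injective (fun c => ℓ c)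
    (fun i j => empFreq N (fun n => (f (x n).1, f (x n).2)) (i, j))
    (fun i j => empFreq_nonneg _ _ _)
    (by rw [← Fintype.sum_prod_type']; exact sum_empFreq hN _) ε D hε hD
    (fun i j hij => hℓ _ _ hij) (fun i j => hdist _ _) _ hρ
  simp only [Finset.sum_sub_distrib, ← Finset.mul_sum, sum_empFreq_prod_right,
    sum_empFreq_prod_left, sum_empFreq_fiber, sum_empFreq_prod_fiber] at h
  refine ENNReal.toReal_le_of_le_ofReal ?_ h
  exact add_nonneg (mul_nonneg hε (indepStat_nonneg _ _ _)) (mul_nonneg hD (indepStat_nonneg _ _ _))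

theorem snd_adaptedEmpirical (φ : UnitCube d → UnitCube d) (N : ℕ)
    (x : ℕ → UnitCube d × UnitCube d) (hN : 0 < N) :
    (adaptedEmpirical φ N x).snd
      = atomicMeasure (fun n : Fin N => φ (x n).2) fun _ => (N : ℝ)⁻¹ := by
  ext s hs
  have hN' : (0 : ℝ) < N := by exact_mod_cast hN
  rw [Measure.snd_apply hs, atomicMeasure_apply _ _ hs, ← Finset.mul_sum, adaptedEmpirical,
    Measure.smul_apply, Measure.finsetSum_apply, Finset.sum_range, smul_eq_mul,
    ENNReal.ofReal_inv_of_pos hN', ENNReal.ofReal_natCast]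
  congr 1
  refine Finset.sum_congr rfl fun n _ => ?_
  rw [Measure.dirac_apply' _ (measurable_snd hs)]
  rfl

theorem wassersteinCorrDen_adaptedEmpirical (φ : UnitCube d → UnitCube d) {N : ℕ} (hN : 0 < N)
    (x : ℕ → UnitCube d × UnitCube d) :
    wassersteinCorrDen (adaptedEmpirical φ N x)
      = ∑ n : Fin N, (N : ℝ)⁻¹ * ∑ m : Fin N, (N : ℝ)⁻¹ * dist (φ (x n).2) (φ (x m).2) := by
  rw [wassersteinCorrDen, snd_adaptedEmpirical φ N x hN, lintegral_atomicMeasure]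
  simp only [lintegral_atomicMeasure]
  have hN' : (0 : ℝ) ≤ (N : ℝ)⁻¹ := by positivity
  rw [ENNReal.toReal_sum fun n _ => ENNReal.mul_ne_top ENNReal.ofReal_ne_top
    (ENNReal.sum_ne_top.2 fun m _ => ENNReal.mul_ne_top ENNReal.ofReal_ne_top (edist_ne_top _ _))]
  refine Finset.sum_congr rfl fun n _ => ?_
  rw [ENNReal.toReal_mul, ENNReal.toReal_ofReal hN', ENNReal.toReal_sum fun m _ =>
    ENNReal.mul_ne_top ENNReal.ofReal_ne_top (edist_ne_top _ _)]
  congr 1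
  refine Finset.sum_congr rfl fun m _ => ?_
  rw [ENNReal.toReal_mul, ENNReal.toReal_ofReal hN', edist_dist, ENNReal.toReal_ofReal dist_nonneg]

open Classical in
/-- Two sets at distance at least `r` bound the denominator from below by their empirical masses,
as soon as the partition is fine compared with `r`. -/
theorem le_wassersteinCorrDen_adaptedEmpirical (φ : UnitCube d → UnitCube d) {N : ℕ} (hN : 0 < N)
    (x : ℕ → UnitCube d × UnitCube d) {U V : Set (UnitCube d)} {r : ℝ}
    (hUV : ∀ u ∈ U, ∀ v ∈ V, r ≤ dist u v) (hφ : ∀ y, dist (φ y) y ≤ r / 4) :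
    r / 2 * (empFreq N (fun n => decide ((x n).2 ∈ U)) true
        * empFreq N (fun n => decide ((x n).2 ∈ V)) true)
      ≤ wassersteinCorrDen (adaptedEmpirical φ N x) := by
  have hN' : (0 : ℝ) ≤ (N : ℝ)⁻¹ := by positivity
  have key : ∀ n m : Fin N, r / 2 * ((if decide ((x n).2 ∈ U) = true then 1 else 0)
      * if decide ((x m).2 ∈ V) = true then 1 else 0) ≤ dist (φ (x n).2) (φ (x m).2) := by
    intro n m
    by_cases h : (x n).2 ∈ U <;> by_cases h' : (x m).2 ∈ V <;> simp [h, h']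
    have h1 := hUV _ h _ h'
    have h2 := hφ (x n).2
    have h3 := hφ (x m).2
    have h4 := dist_triangle4 (x n).2 (φ (x n).2) (φ (x m).2) (x m).2
    rw [dist_comm (x n).2 (φ (x n).2)] at h4
    linarith
  rw [wassersteinCorrDen_adaptedEmpirical φ hN, empFreq, empFreq, div_eq_inv_mul _ (N : ℝ),
    div_eq_inv_mul _ (N : ℝ), Finset.sum_range, Finset.sum_range]
  calc _ = ∑ n : Fin N, (N : ℝ)⁻¹ * ∑ m : Fin N, (N : ℝ)⁻¹ *
        (r / 2 * ((if decide ((x n).2 ∈ U) = true then 1 else 0)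
          * if decide ((x m).2 ∈ V) = true then 1 else 0)) := by
        rw [mul_mul_mul_comm, Finset.sum_mul_sum]
        simp only [Finset.mul_sum]
        refine Finset.sum_congr rfl fun n _ => Finset.sum_congr rfl fun m _ => ?_
        ring
    _ ≤ _ := Finset.sum_le_sum fun n _ => mul_le_mul_of_nonneg_left
        (Finset.sum_le_sum fun m _ => mul_le_mul_of_nonneg_left (key n m) hN') hN'

end Adapted

/-! ### Partitions of the cube and non-atomic measures -/

section Geometry

instance instCompactSpaceUnitCube (d : ℕ) : CompactSpace (UnitCube d) := by
  refine isCompact_iff_compactSpace.1 (Metric.isCompact_of_isClosed_isBounded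
    (isClosed_unitCubeSet d) (isBounded_iff_forall_norm_le.2 ⟨√d, fun x hx => ?_⟩))
  rw [EuclideanSpace.norm_eq]
  refine Real.sqrt_le_sqrt ?_
  calc ∑ i, ‖x i‖ ^ 2 ≤ ∑ _i : Fin d, (1 : ℝ) := Finset.sum_le_sum fun i _ => by
        rw [Real.norm_eq_abs, sq_abs]
        nlinarith [(hx i).1, (hx i).2]
    _ = d := by simp

/-- A compact space is divided into finitely many sets of small diameter: the fibres of `ℓ`. -/
theorem exists_finite_label {X : Type*} [MetricSpace X] [CompactSpace X] {ε : ℝ} (hε : 0 < ε) :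
    ∃ (t : Finset X) (ℓ : X → t), ∀ x y, ℓ x = ℓ y → dist x y ≤ ε := by
  obtain ⟨t, -, ht, hcov⟩ := Metric.finite_approx_of_totallyBounded
    (isCompact_univ (X := X)).totallyBounded (ε / 2) (half_pos hε)
  have hmem : ∀ x : X, ∃ c : ht.toFinset, dist x (c : X) < ε / 2 := fun x => by
    obtain ⟨c, hc, hx⟩ := Set.mem_iUnion₂.1 (hcov (Set.mem_univ x))
    exact ⟨⟨c, ht.mem_toFinset.2 hc⟩, hx⟩
  choose ℓ hℓ using hmem
  refine ⟨ht.toFinset, ℓ, fun x y hxy => ?_⟩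
  have h1 := hℓ x
  have h2 := hℓ y
  rw [← hxy] at h2
  have := dist_triangle_right x y (ℓ x)
  linarith

/-- A non-atomic probability measure charges every neighbourhood of each of two distinct points. -/
theorem exists_separated_of_nonatomic {X : Type*} [MetricSpace X] [SecondCountableTopology X]
    [MeasurableSpace X] [BorelSpace X] (ν : Measure X) [IsProbabilityMeasure ν]
    (hν : ∀ x, ν {x} = 0) :
    ∃ (U V : Set X) (r : ℝ), MeasurableSet U ∧ MeasurableSet V ∧ 0 < r ∧ 0 < ν U ∧ 0 < ν V ∧
      ∀ u ∈ U, ∀ v ∈ V, r ≤ dist u v := by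
  obtain ⟨x, -, hx⟩ := exists_mem_forall_mem_nhdsWithin_pos_measure (μ := ν) (s := Set.univ)
    (by simp)
  have hc : ν {x}ᶜ ≠ 0 := by
    rw [measure_compl (measurableSet_singleton x) (by simp [hν]), hν]
    simp
  obtain ⟨y, hyx, hy⟩ := exists_mem_forall_mem_nhdsWithin_pos_measure hc
  have hr : 0 < dist x y := dist_pos.2 fun h => hyx h.symm
  refine ⟨Metric.ball x (dist x y / 4), Metric.ball y (dist x y / 4), dist x y / 2,
    measurableSet_ball, measurableSet_ball, by linarith, hx _ ?_, hy _ ?_, ?_⟩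
  · rw [nhdsWithin_univ]
    exact Metric.ball_mem_nhds _ (by linarith)
  · exact mem_nhdsWithin_of_mem_nhds (Metric.ball_mem_nhds _ (by linarith))
  · intro u hu v hv
    have h1 : dist u x < dist x y / 4 := hu
    have h2 : dist v y < dist x y / 4 := hv
    have h3 := dist_triangle4 x u v y
    rw [dist_comm x u] at h3
    linarith

variable {d : ℕ}

theorem dist_le_iSup_dist (φ : UnitCube d → UnitCube d) (x : UnitCube d) :
    dist (φ x) x ≤ ⨆ x, dist (φ x) x :=
  le_ciSup (f := fun x => dist (φ x) x) ⟨Metric.diam (Set.univ : Set (UnitCube d)), by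
    rintro _ ⟨y, rfl⟩
    exact Metric.dist_le_diam_of_mem isCompact_univ.isBounded (Set.mem_univ _) (Set.mem_univ _)⟩ x

theorem ncard_cubeCells (φ : UnitCube d → UnitCube d) :
    (cubeCells φ).ncard = (Set.range φ).ncard := by
  have h : cubeCells φ = (fun c => φ ⁻¹' {c}) '' Set.range φ := by
    ext G
    simp only [cubeCells, Set.mem_ofPred_eq, Set.mem_image, eq_comm]
  rw [h, Set.InjOn.ncard_image]
  rintro _ ⟨x, rfl⟩ c' - hcc
  have hx : x ∈ φ ⁻¹' {φ x} := rfl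
  exact (Set.ext_iff.1 hcc x).1 hx

/-- `φ` is measurable even with respect to the discrete σ-algebra on its codomain, because its
range is finite. -/
theorem IsCubeCentreMap.measurableSet_preimage {φ : UnitCube d → UnitCube d}
    (hφ : IsCubeCentreMap φ) (A : Set (UnitCube d)) : MeasurableSet (φ ⁻¹' A) := by
  have h : φ ⁻¹' A = ⋃ c ∈ Set.range φ ∩ A, φ ⁻¹' {c} := by
    ext x
    simp only [Set.mem_iUnion, Set.mem_preimage, Set.mem_singleton_iff, exists_prop]
    exact ⟨fun hx => ⟨φ x, ⟨⟨x, rfl⟩, hx⟩, rfl⟩, fun ⟨c, hc, hxc⟩ => hxc ▸ hc.2⟩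
  rw [h]
  exact (hφ.finite_range.inter_of_left A).measurableSet_biUnion
    fun c hc => (hφ.isCube_fibre c hc.1).1

/-- A map that moves points only a little is injective on any given finite set, so the number of
cells tends to infinity with the fineness of the partition. -/
theorem tendsto_ncard_range (hinf : Infinite (UnitCube d)) (φ : ℕ → UnitCube d → UnitCube d)
    (hφ : ∀ N, (Set.range (φ N)).Finite)
    (hlim : Tendsto (fun N => ⨆ x, dist (φ N x) x) atTop (𝓝 0)) :
    Tendsto (fun N => (Set.range (φ N)).ncard) atTop atTop := by
  refine tendsto_atTop.2 fun M => ?_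
  obtain ⟨s, hs⟩ := Infinite.exists_subset_card_eq (UnitCube d) M
  obtain ⟨δ, hδ, hsep⟩ : ∃ δ : ℝ, 0 < δ ∧ ∀ x ∈ s, ∀ y ∈ s, x ≠ y → δ ≤ dist x y := by
    obtain ⟨C, hC, hsep⟩ := Set.einfsep_pos.1 (s.finite_toSet.einfsep_pos)
    have hne : min C 1 ≠ ∞ := ((min_le_right _ _).trans_lt ENNReal.one_lt_top).ne
    refine ⟨(min C 1).toReal, ENNReal.toReal_pos (lt_min hC one_pos).ne' hne,
      fun x hx y hy hxy => ?_⟩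
    rw [dist_edist]
    exact ENNReal.toReal_mono (edist_ne_top _ _) ((min_le_left _ _).trans (hsep x hx y hy hxy))
  filter_upwards [hlim.eventually_lt_const (half_pos hδ)] with N hN
  rw [← hs, ← Set.ncard_coe_finset]
  refine Set.ncard_le_ncard_of_injOn (φ N) (fun x _ => ⟨x, rfl⟩) (fun x hx y hy hxy => ?_) (hφ N)
  by_contra hne
  have h1 := hsep x hx y hy hne
  have h2 := (dist_le_iSup_dist (φ N) x).trans_lt hN
  have h3 := (dist_le_iSup_dist (φ N) y).trans_lt hN
  rw [← hxy] at h3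
  have h4 := dist_triangle_left x y (φ N x)
  linarith

theorem infinite_of_nonatomic {X : Type*} [MeasurableSpace X] (ν : Measure X)
    [IsProbabilityMeasure ν] (hν : ∀ x, ν {x} = 0) : Infinite X := by
  by_contra h
  rw [not_infinite_iff_finite] at h
  have h1 : ν Set.univ = 0 := (measure_null_iff_singleton Set.countable_univ).2 fun x _ => hν x
  simp at h1

end Geometry

/-! ### Asymptotics of the rejection probability -/

section Asymptotics

variable {d : ℕ} {μ ν : Measure (UnitCube d)} [IsProbabilityMeasure μ] [IsProbabilityMeasure ν]
  {Ω : Type*} [MeasurableSpace Ω] {P : Measure Ω} [IsProbabilityMeasure P]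
  {X : ℕ → Ω → UnitCube d × UnitCube d}

theorem measureReal_le_of_le_integral {f U : Ω → ℝ} (hf : ∀ ω, 0 ≤ f ω) (hU : Integrable U P)
    (hfU : ∀ ω, f ω ≤ U ω) {c b : ℝ} (hc : 0 < c) (hb : ∫ ω, U ω ∂P ≤ b) :
    P.real {ω | c ≤ f ω} ≤ b / c := by
  have h1 := mul_meas_ge_le_integral_of_nonneg
    (ae_of_all P fun ω => (hf ω).trans (hfU ω)) hU c
  have h2 : P.real {ω | c ≤ f ω} ≤ P.real {ω | c ≤ U ω} :=
    measureReal_mono fun ω hω => le_trans hω (hfU ω)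
  rw [le_div_iff₀ hc]
  nlinarith

/-- The numerator exceeds `c m / √N`, where `m` is the number of cells, with probability at most
`2 (ε + D √(K / m)) / c`, if the cube is divided into `K` sets of diameter at most `ε`. The factor
in front of `1 / c` can be made arbitrarily small, because `m` tends to infinity. -/
theorem measureReal_wassersteinCorrNum_ge_le (hX : ∀ n, Measurable (X n))
    (hlaw : ∀ n, P.map (X n) = μ.prod ν) (hind : iIndepFun X P) {φ : UnitCube d → UnitCube d}
    (hφ : IsCubeCentreMap φ) {κ : Type*} [Fintype κ] (ℓ : UnitCube d → κ) {ε D : ℝ} (hε : 0 ≤ ε)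
    (hD : 0 ≤ D) (hℓ : ∀ x y, ℓ x = ℓ y → dist x y ≤ ε)
    (hdist : ∀ x y : UnitCube d, dist x y ≤ D) {N : ℕ} (hN : 0 < N) {c : ℝ} (hc : 0 < c) :
    P.real {ω | c * ((Set.range φ).ncard / √(N : ℝ))
        ≤ wassersteinCorrNum (adaptedEmpirical φ N fun n => X n ω)}
      ≤ 2 * (ε + D * √(Fintype.card κ / (Set.range φ).ncard)) / c := by
  classical
  have := hφ.finite_range.fintype
  have hN' : (0 : ℝ) < √(N : ℝ) := Real.sqrt_pos.2 (by exact_mod_cast hN)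
  set m : ℝ := ((Set.range φ).ncard : ℝ) with hm
  have hcard : (Fintype.card (Set.range φ) : ℝ) = m := by
    rw [hm, Set.ncard_eq_toFinset_card', Set.toFinset_card]
  have hm0 : 0 < m := by
    rw [← hcard]
    exact_mod_cast Fintype.card_pos
  have hmeas : ∀ i, MeasurableSet (Set.rangeFactorization φ ⁻¹' {i}) := fun i => by
    have : Set.rangeFactorization φ ⁻¹' {i} = φ ⁻¹' {(i : UnitCube d)} := by
      ext x
      exact Subtype.ext_iff
    rw [this]
    exact hφ.measurableSet_preimage _
  obtain ⟨U₁, hU₁, hle₁, hint₁⟩ := exists_indepStat_le hX hlaw hind hN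
    (Set.rangeFactorization φ) (Set.rangeFactorization φ) hmeas hmeas
  obtain ⟨U₂, hU₂, hle₂, hint₂⟩ := exists_indepStat_le hX hlaw hind hN
    (Set.rangeFactorization φ) (fun x => ℓ (φ x)) hmeas
    fun k => hφ.measurableSet_preimage (ℓ ⁻¹' {k})
  have hb : ∫ ω, (ε * U₁ ω + D * U₂ ω) ∂P
      ≤ 2 * (ε + D * √(Fintype.card κ / m)) * (m / √(N : ℝ)) := by
    rw [integral_add (hU₁.const_mul _) (hU₂.const_mul _), integral_const_mul, integral_const_mul]
    have e1 : √(Fintype.card (Set.range φ) * Fintype.card (Set.range φ) / (N : ℝ))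
        = m / √(N : ℝ) := by
      rw [hcard, Real.sqrt_div (by positivity), Real.sqrt_mul_self hm0.le]
    have e2 : √(Fintype.card (Set.range φ) * Fintype.card κ / (N : ℝ))
        = √(Fintype.card κ / m) * (m / √(N : ℝ)) := by
      have : m * Fintype.card κ = Fintype.card κ / m * (m * m) := by field_simp
      rw [hcard, Real.sqrt_div (by positivity), this, Real.sqrt_mul (by positivity),
        Real.sqrt_mul_self hm0.le, mul_div_assoc]
    rw [e1] at hint₁
    rw [e2] at hint₂
    calc _ ≤ ε * (2 * (m / √(N : ℝ))) + D * (2 * (√(Fintype.card κ / m) * (m / √(N : ℝ)))) :=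
          add_le_add (mul_le_mul_of_nonneg_left hint₁ hε) (mul_le_mul_of_nonneg_left hint₂ hD)
      _ = _ := by ring
  refine (measureReal_le_of_le_integral (fun ω => ENNReal.toReal_nonneg)
    ((hU₁.const_mul ε).add (hU₂.const_mul D)) (fun ω => ?_) (by positivity) hb).trans
    (le_of_eq ?_)
  · exact (wassersteinCorrNum_adaptedEmpirical_le φ ℓ hε hD hℓ hdist hN _).trans
      (add_le_add (mul_le_mul_of_nonneg_left (hle₁ ω) hε) (mul_le_mul_of_nonneg_left (hle₂ ω) hD))
  · rw [mul_div_mul_right _ _ (by positivity)]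

open Classical in
/-- A weak law of large numbers for the empirical mass of a set. -/
theorem measureReal_empFreq_lt_le (hX : ∀ n, Measurable (X n))
    (hlaw : ∀ n, P.map (X n) = μ.prod ν) (hind : iIndepFun X P) {U : Set (UnitCube d)}
    (hU : MeasurableSet U) (hpos : 0 < ν U) {N : ℕ} (hN : 0 < N) :
    P.real {ω | empFreq N (fun n => decide ((X n ω).2 ∈ U)) true < ν.real U / 2}
      ≤ √(1 / (N : ℝ)) / (ν.real U / 2) := by
  have hpos' : 0 < ν.real U := ENNReal.toReal_pos hpos.ne' (measure_ne_top _ _)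
  have hpre : (fun y => decide (y ∈ U)) ⁻¹' {true} = U := by
    ext y
    simp
  have hint := integral_abs_sum_centredIndicator_le hX hlaw hind N MeasurableSet.univ hU
  have hb : √(μ.real Set.univ * ν.real U / N) ≤ √(1 / (N : ℝ)) := by
    refine Real.sqrt_le_sqrt (div_le_div_of_nonneg_right ?_ (Nat.cast_nonneg N))
    rw [probReal_univ, one_mul]
    exact measureReal_le_one
  refine le_trans (measureReal_mono fun ω hω => ?_) (measureReal_le_of_le_integral
    (fun ω => abs_nonneg _) ((integrable_finsetSum _ fun n _ =>
      (memLp_centredIndicator_comp hX MeasurableSet.univ hU n).integrable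
        one_le_two).div_const _).abs (fun ω => le_rfl) (half_pos hpos') (hint.trans hb))
  have h := empFreq_sub_eq ν hN (fun y => decide (y ∈ U)) true fun n => X n ω
  rw [hpre] at h
  have hω' : empFreq N (fun n => decide ((X n ω).2 ∈ U)) true < ν.real U / 2 := hω
  show ν.real U / 2 ≤ |_|
  rw [← h]
  refine le_trans ?_ (neg_le_abs _)
  linarith

/-- The denominator stays away from `0` with probability tending to `1`. -/
theorem exists_tendsto_measureReal_wassersteinCorrDen_lt (hν : ∀ x, ν {x} = 0)
    (hX : ∀ n, Measurable (X n))
    (hlaw : ∀ n, P.map (X n) = μ.prod ν) (hind : iIndepFun X P) {φ : ℕ → UnitCube d → UnitCube d}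
    (hlim : Tendsto (fun N => ⨆ x, dist (φ N x) x) atTop (𝓝 0)) :
    ∃ δ : ℝ, 0 < δ ∧ Tendsto (fun N => P.real {ω |
      wassersteinCorrDen (adaptedEmpirical (φ N) N fun n => X n ω) < δ}) atTop (𝓝 0) := by
  classical
  obtain ⟨U, V, r, hU, hV, hr, hUpos, hVpos, hUV⟩ := exists_separated_of_nonatomic ν hν
  have hu : 0 < ν.real U := ENNReal.toReal_pos hUpos.ne' (measure_ne_top _ _)
  have hv : 0 < ν.real V := ENNReal.toReal_pos hVpos.ne' (measure_ne_top _ _)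
  refine ⟨r / 2 * (ν.real U / 2 * (ν.real V / 2)), by positivity, ?_⟩
  have hsq : Tendsto (fun N : ℕ => √(1 / (N : ℝ))) atTop (𝓝 0) := by
    have := (Real.continuous_sqrt.tendsto 0).comp tendsto_one_div_atTop_nhds_zero_nat
    rwa [Real.sqrt_zero] at this
  have hbound : Tendsto (fun N : ℕ => √(1 / (N : ℝ)) / (ν.real U / 2)
      + √(1 / (N : ℝ)) / (ν.real V / 2)) atTop (𝓝 0) := by
    simpa using (hsq.div_const (ν.real U / 2)).add (hsq.div_const (ν.real V / 2))
  refine tendsto_of_tendsto_of_tendsto_of_le_of_le' tendsto_const_nhds hbound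
    (Eventually.of_forall fun N => measureReal_nonneg) ?_
  filter_upwards [hlim.eventually_lt_const (by positivity : (0 : ℝ) < r / 4),
    eventually_gt_atTop 0] with N hmesh hN
  refine le_trans (measureReal_mono fun ω hω => ?_) ((measureReal_union_le _ _).trans
    (add_le_add (measureReal_empFreq_lt_le hX hlaw hind hU hUpos hN)
      (measureReal_empFreq_lt_le hX hlaw hind hV hVpos hN)))
  by_contra hcon
  simp only [Set.mem_union, Set.mem_ofPred_eq, not_or, not_lt] at hcon hω
  have h1 := le_wassersteinCorrDen_adaptedEmpirical (φ N) hN (fun n => X n ω) hUV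
    fun y => (dist_le_iSup_dist (φ N) y).trans hmesh.le
  have h2 := mul_le_mul hcon.1 hcon.2 (by positivity) (empFreq_nonneg _ _ _)
  have h3 := mul_le_mul_of_nonneg_left h2 (by positivity : 0 ≤ r / 2)
  linarith

/-- For every `c > 0`, the probability that the Wasserstein correlation coefficient exceeds
`c m / √N`, where `m` is the number of cells, tends to `0`. -/
theorem tendsto_measureReal_wassersteinCorr_gt (hν : ∀ x, ν {x} = 0) (hX : ∀ n, Measurable (X n))
    (hlaw : ∀ n, P.map (X n) = μ.prod ν) (hind : iIndepFun X P) {φ : ℕ → UnitCube d → UnitCube d}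
    (hφ : ∀ N, IsCubeCentreMap (φ N))
    (hlim : Tendsto (fun N => ⨆ x, dist (φ N x) x) atTop (𝓝 0)) {c : ℝ} (hc : 0 < c) :
    Tendsto (fun N : ℕ => P.real {ω | c * ((Set.range (φ N)).ncard / √(N : ℝ))
      < wassersteinCorr (adaptedEmpirical (φ N) N fun n => X n ω)}) atTop (𝓝 0) := by
  obtain ⟨δ, hδ, hden⟩ :=
    exists_tendsto_measureReal_wassersteinCorrDen_lt hν hX hlaw hind hlim
  set D := Metric.diam (Set.univ : Set (UnitCube d))
  have hD : 0 ≤ D := Metric.diam_nonneg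
  have hdist : ∀ x y : UnitCube d, dist x y ≤ D := fun x y =>
    Metric.dist_le_diam_of_mem isCompact_univ.isBounded (Set.mem_univ _) (Set.mem_univ _)
  refine (tendsto_order.2 ⟨fun a ha => Eventually.of_forall fun N =>
    ha.trans_le measureReal_nonneg, fun η hη => ?_⟩)
  -- Both terms of the numerator bound are made at most `ε`, so that it becomes `4ε/(cδ) = η/2`.
  set ε := η * (c * δ) / 8 with hε
  have hε0 : 0 < ε := by positivity
  obtain ⟨t, ℓ, hℓ⟩ := exists_finite_label (X := UnitCube d) hε0
  have hm : Tendsto (fun N => ((Set.range (φ N)).ncard : ℝ)) atTop atTop :=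
    tendsto_natCast_atTop_atTop.comp (tendsto_ncard_range (infinite_of_nonatomic ν hν) φ
      (fun N => (hφ N).finite_range) hlim)
  have hsmall : Tendsto (fun N => D * √(Fintype.card t / (Set.range (φ N)).ncard)) atTop
      (𝓝 0) := by
    have := ((Real.continuous_sqrt.tendsto 0).comp
      (hm.const_div_atTop (Fintype.card t : ℝ))).const_mul D
    simpa using this
  filter_upwards [hsmall.eventually_lt_const hε0, hden.eventually_lt_const (half_pos hη),
    eventually_gt_atTop 0] with N h1 h2 hN
  have h3 := measureReal_wassersteinCorrNum_ge_le hX hlaw hind (hφ N) ℓ hε0.le hD hℓ hdist hN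
    (mul_pos hc hδ)
  have h4 : 2 * (ε + D * √(Fintype.card t / (Set.range (φ N)).ncard)) / (c * δ) ≤ η / 2 := by
    rw [div_le_iff₀ (by positivity)]
    have : ε = η * (c * δ) / 8 := hε
    linarith
  have h5 : {ω | c * ((Set.range (φ N)).ncard / √(N : ℝ))
        < wassersteinCorr (adaptedEmpirical (φ N) N fun n => X n ω)}
      ⊆ {ω | c * δ * ((Set.range (φ N)).ncard / √(N : ℝ))
          ≤ wassersteinCorrNum (adaptedEmpirical (φ N) N fun n => X n ω)}
        ∪ {ω | wassersteinCorrDen (adaptedEmpirical (φ N) N fun n => X n ω) < δ} := by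
    intro ω hω
    by_contra hcon
    simp only [Set.mem_union, Set.mem_ofPred_eq, not_or, not_lt, not_le] at hcon hω
    have h6 : wassersteinCorr (adaptedEmpirical (φ N) N fun n => X n ω)
        = wassersteinCorrNum (adaptedEmpirical (φ N) N fun n => X n ω)
          / wassersteinCorrDen (adaptedEmpirical (φ N) N fun n => X n ω) := rfl
    rw [h6, lt_div_iff₀ (hδ.trans_le hcon.2)] at hω
    have h7 : 0 ≤ c * ((Set.range (φ N)).ncard / √(N : ℝ)) := by positivity
    have h8 := mul_le_mul_of_nonneg_left hcon.2 h7
    linarith [hcon.1]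
  calc _ ≤ _ := measureReal_mono h5
    _ ≤ _ := measureReal_union_le _ _
    _ < η / 2 + η / 2 := add_lt_add_of_le_of_lt (h3.trans h4) h2
    _ = η := add_halves η

end Asymptotics

theorem half_lt_sqrt_two_div_pi : 1 / 2 < √(2 / Real.pi) := by
  rw [Real.lt_sqrt (by norm_num), lt_div_iff₀ Real.pi_pos]
  linarith [Real.pi_le_four, Real.pi_lt_d2]

theorem mainTheorem5 (d : ℕ) (ν : Measure (UnitCube d)) [IsProbabilityMeasure ν]
    (hν : ∀ x, ν {x} = 0) :
    ∃ C : ℝ, 0 < C ∧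
      ∀ (μ : Measure (UnitCube d)) [IsProbabilityMeasure μ],
        (∀ x, μ {x} = 0) →
      ∀ (φ : ℕ → UnitCube d → UnitCube d),
        (∀ N, IsCubeCentreMap (φ N)) →
        Tendsto (fun N => ⨆ x, dist (φ N x) x) atTop (𝓝 0) →
        ∀ (α : ℝ), 0 < α → α < 1 →
        ∀ (Ω : Type*) [MeasurableSpace Ω] (P : Measure Ω) [IsProbabilityMeasure P]
          (X : ℕ → Ω → UnitCube d × UnitCube d),
          (∀ n, Measurable (X n)) →
          (∀ n, P.map (X n) = μ.prod ν) →
          iIndepFun X P →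
          limsup (fun N : ℕ => P {ω |
              wassersteinCorr (adaptedEmpirical (φ N) N (fun n => X n ω)) >
                C * (√(2 / Real.pi) * ((cubeCells (φ N)).ncard / √(N : ℝ))
                  + (1 - 2 / Real.pi) / √(N : ℝ) * stdNormalQuantile (1 - α))}) atTop
            ≤ ENNReal.ofReal α := by
  -- The rejection probability tends to `0` for every positive constant, in particular for `1`.
  refine ⟨1, one_pos, fun μ _ _ φ hφ hlim α _ _ Ω _ P _ X hX hlaw hind => ?_⟩
  have hm : Tendsto (fun N => ((Set.range (φ N)).ncard : ℝ)) atTop atTop :=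
    tendsto_natCast_atTop_atTop.comp (tendsto_ncard_range (infinite_of_nonatomic ν hν) φ
      (fun N => (hφ N).finite_range) hlim)
  have hgap : 0 < √(2 / Real.pi) - 1 / 2 := sub_pos.2 half_lt_sqrt_two_div_pi
  have hzero := tendsto_measureReal_wassersteinCorr_gt hν hX hlaw hind hφ hlim
    (one_half_pos (α := ℝ))
  have hzero' : Tendsto (fun N : ℕ => P {ω | 1 / 2 * ((Set.range (φ N)).ncard / √(N : ℝ))
      < wassersteinCorr (adaptedEmpirical (φ N) N fun n => X n ω)}) atTop (𝓝 0) := by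
    have h : ∀ s : Set Ω, ENNReal.ofReal (P.real s) = P s := fun s => ofReal_measureReal
    simpa only [h, ENNReal.ofReal_zero] using ENNReal.tendsto_ofReal hzero
  refine le_of_eq_of_le (Tendsto.limsup_eq ?_) zero_le
  refine tendsto_of_tendsto_of_tendsto_of_le_of_le' tendsto_const_nhds hzero'
    (Eventually.of_forall fun N => zero_le) ?_
  -- As the number of cells tends to infinity, the term with the quantile is eventually negligible.
  filter_upwards [hm.eventually_ge_atTop
    (-((1 - 2 / Real.pi) * stdNormalQuantile (1 - α)) / (√(2 / Real.pi) - 1 / 2))] with N hN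
  refine measure_mono fun ω hω => ?_
  rw [Set.mem_ofPred_eq] at hω ⊢
  refine lt_of_le_of_lt ?_ hω
  rw [div_le_iff₀ hgap] at hN
  have hthr : √(2 / Real.pi) * ((Set.range (φ N)).ncard / √(N : ℝ))
        + (1 - 2 / Real.pi) / √(N : ℝ) * stdNormalQuantile (1 - α)
      = (√(2 / Real.pi) * (Set.range (φ N)).ncard
        + (1 - 2 / Real.pi) * stdNormalQuantile (1 - α)) / √(N : ℝ) := by ring
  rw [one_mul, ncard_cubeCells, hthr, ← mul_div_assoc]
  exact div_le_div_of_nonneg_right (by linarith) (Real.sqrt_nonneg _)
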